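/- Let $n \ge 1$, let $S^n$ be the unit sphere in $\mathbb R^{n+1}$ with its standard round distance $\mathrm{dist}$, and let $B^{n+1}$ be the open unit ball with its hyperbolic metric. A Kleinian group is a discrete subgroup $\Gamma$ of the group of conformal (Möbius) transformations of $S^n$ whose domain of discontinuity $\Omega(\Gamma) \subset S^n$ (the set of points having a neighbourhood $U$ with $\gamma U \cap U \ne \emptyset$ for only finitely many $\gamma \in \Gamma$) is non-empty; $L(\Gamma) = \partial\Omega(\Gamma)$ is its limit set, and $\Gamma$ is nonelementary if $L(\Gamma)$ has more than two points. $\Gamma$ acts on $B^{n+1}$ by the hyperbolic isometries that extend its elements continuously. For $\epsilon_0 > 0$ let $B(\Gamma)$ be the collection of all images $\gamma\bigl(B(x, \epsilon_0\,\mathrm{dist}(x, L(\Gamma)))\bigr)$ with $\gamma \in \Gamma$, $x \in \Omega(\Gamma)$, where $B(x,r)$ is the open ball of centre $x$ and radius $r$ in $S^n$. For a ball $B_\beta \in B(\Gamma)$ let $H_\beta \subset B^{n+1}$ be the open hyperbolic half-space over $B_\beta$, i.e. the one bounded by the dome that meets $S^n$ orthogonally in $\partial B_\beta$. Set $$G(\Gamma)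 = \partial\Bigl(\bigcup_\beta H_\beta\Bigr) \cap B^{n+1}.$$ **Proposition 1.1.** There are functions $C_1, C_2 : (0,\infty) \to (0,\infty)$ such that for every $n$ and every nonelementary Kleinian group $\Gamma$ on $S^n$ there is $\epsilon_1 = \epsilon_1(\Gamma) > 0$ such that for every $0 < \epsilon_0 < \epsilon_1$ the set $G(\Gamma)$ is a $\Gamma$-invariant Lipschitz graph over $\Omega(\Gamma)$: it is $\Gamma$-invariant, and there are $f : \Omega(\Gamma) \to (0,1)$ and $M > 0$ with $$G(\Gamma) = \{ f(x)\,x : x \in \Omega(\Gamma)\}, \qquad |f(x) - f(y)| \le M\,\mathrm{dist}(x,y) \quad \text{for all } x, y \in \Omega(\Gamma).$$ Moreover $$0 < C_1(\epsilon_0) \le \frac{1 - f(x)}{\mathrm{dist}(x, L(\Gamma))} \le C_2(\epsilon_0) \qquad \text{for all } x \in \Omega(\Gamma).$$ -/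

import Mathlib

noncomputable section

namespace KleinianGraph

/-- The Euclidean space of dimension `n + 1`. -/
abbrev Euc (n : ℕ) : Type := EuclideanSpace ℝ (Fin (n + 1))

/-- The unit sphere of dimension `n`. -/
abbrev Sph (n : ℕ) : Type := Metric.sphere (0 : Euc n) 1

/-- The open unit ball of dimension `n + 1`. -/
def unitBall (n : ℕ) : Set (Euc n) := Metric.ball 0 1

/-! ### Spherical geometry -/

/-- The distance of the standard round metric of the sphere, i.e. the angle `arccos ⟪x, y⟫`. -/
def sphDist {n : ℕ} (x y : Sph n) : ℝ :=
  InnerProductGeometry.angle (x : Euc n) (y : Euc n)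

/-- The spherical distance from a point to a (non-empty) subset of the sphere. -/
def sphInfDist {n : ℕ} (x : Sph n) (A : Set (Sph n)) : ℝ :=
  ⨅ a : A, sphDist x a

/-- The open ball of the round metric with centre `y` and radius `r`. -/
def sphBall {n : ℕ} (y : Sph n) (r : ℝ) : Set (Sph n) :=
  {x | sphDist x y < r}

/-! ### Conformal (Möbius) transformations of the sphere -/

/-- `φ` is the reflection of the sphere in one of its spheres of codimension one: either in the
sphere cut out by the Euclidean sphere with centre `c`, `‖c‖ > 1`, and radius `R` that is
orthogonal to the unit sphere (`R ^ 2 = ‖c‖ ^ 2 - 1`), where it is the Euclidean inversion, or in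
the great sphere orthogonal to a vector `v ≠ 0`, where it is the Euclidean reflection. -/
def IsSphereReflection {n : ℕ} (φ : Sph n ≃ₜ Sph n) : Prop :=
  (∃ (c : Euc n) (R : ℝ), 1 < ‖c‖ ∧ R ^ 2 = ‖c‖ ^ 2 - 1 ∧
    ∀ x : Sph n, (φ x : Euc n) = EuclideanGeometry.inversion c R (x : Euc n)) ∨
  (∃ v : Euc n, v ≠ 0 ∧
    ∀ x : Sph n, (φ x : Euc n) = (Submodule.span ℝ {v})ᗮ.reflection (x : Euc n))

/-- The group of conformal transformations of the unit sphere, i.e. the Möbius group: all finite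
compositions of reflections in spheres of codimension one. -/
def conformalGroup (n : ℕ) : Subgroup (Sph n ≃ₜ Sph n) :=
  Subgroup.closure {φ | IsSphereReflection φ}

/-- The hyperbolic distance (of curvature `-1`) of two points of the open unit ball. -/
def hypDist {n : ℕ} (z w : Euc n) : ℝ :=
  2 * Real.arsinh (‖z - w‖ / Real.sqrt ((1 - ‖z‖ ^ 2) * (1 - ‖w‖ ^ 2)))

/-- `Φ` is, on the closed unit ball, the continuous extension of the transformation `γ` of the
sphere which is an isometry of hyperbolic space on the open unit ball (values of `Φ` outside the
closed ball are irrelevant). This is how `γ` acts on the ball. -/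
structure IsPoincareExtension {n : ℕ} (γ : Sph n ≃ₜ Sph n) (Φ : Euc n → Euc n) : Prop where
  continuousOn : ContinuousOn Φ (Metric.closedBall 0 1)
  eq_on_sphere : ∀ x : Sph n, Φ x = γ x
  bijOn : Set.BijOn Φ (unitBall n) (unitBall n)
  isometry : ∀ z ∈ unitBall n, ∀ w ∈ unitBall n, hypDist (Φ z) (Φ w) = hypDist z w

/-- The subset `A` of the ball is invariant under the action of `Γ` by hyperbolic isometries. -/
def IsInvariantUnder {n : ℕ} (Γ : Subgroup (Sph n ≃ₜ Sph n)) (A : Set (Euc n)) : Prop :=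
  ∀ γ ∈ Γ, ∃ Φ : Euc n → Euc n, IsPoincareExtension γ Φ ∧ Φ '' A = A

/-! ### Kleinian groups -/

/-- The domain of discontinuity `Ω(Γ)`: the points of the sphere with a neighbourhood that meets
only finitely many of its translates by elements of `Γ`. -/
def discontinuityDomain {n : ℕ} (Γ : Subgroup (Sph n ≃ₜ Sph n)) : Set (Sph n) :=
  {x | ∃ U : Set (Sph n), IsOpen U ∧ x ∈ U ∧
    {γ : Sph n ≃ₜ Sph n | γ ∈ Γ ∧ (γ '' U ∩ U).Nonempty}.Finite}

/-- The limit set `L(Γ)`, as the boundary in the sphere of the domain of discontinuity. -/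
def limitSet {n : ℕ} (Γ : Subgroup (Sph n ≃ₜ Sph n)) : Set (Sph n) :=
  frontier (discontinuityDomain Γ)

/-- A Kleinian group: a discrete group of conformal transformations of the sphere whose domain of
discontinuity is not empty. Discreteness is with respect to uniform convergence on the sphere: the
identity is isolated. -/
structure IsKleinian {n : ℕ} (Γ : Subgroup (Sph n ≃ₜ Sph n)) : Prop where
  conformal : Γ ≤ conformalGroup n
  discrete : ∃ δ > 0, ∀ γ ∈ Γ, (∀ x, sphDist (γ x) x < δ) → γ = 1
  nonempty : (discontinuityDomain Γ).Nonempty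

/-- A group is nonelementary if it has more than two limit points. -/
def IsNonelementary {n : ℕ} (Γ : Subgroup (Sph n ≃ₜ Sph n)) : Prop :=
  2 < (limitSet Γ).encard

/-! ### The invariant graph -/

/-- The hyperbolic half-space of the unit ball over the spherical ball with centre `y` and radius
`r`, `0 < r < π`. Its boundary in the ball, where `2 * ⟪z, y⟫ = (1 + ‖z‖ ^ 2) * cos r`, lies on the
Euclidean sphere with centre `y / cos r` and radius `|tan r|` (on the hyperplane orthogonal to `y`
if `r = π / 2`), which meets the unit sphere orthogonally in the boundary of the spherical ball. -/
def halfSpace {n : ℕ} (y : Sph n) (r : ℝ) : Set (Euc n) :=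
  {z | z ∈ unitBall n ∧ (1 + ‖z‖ ^ 2) * Real.cos r < 2 * inner ℝ z (y : Euc n)}

/-- The hyperbolic half-space over a subset `D` of the sphere that is a spherical ball. (For
`1 ≤ n` the centre `y` and the radius `r` are determined by `D`.) -/
def halfSpaceOver {n : ℕ} (D : Set (Sph n)) : Set (Euc n) :=
  {z | ∃ (y : Sph n) (r : ℝ), 0 < r ∧ r < Real.pi ∧ D = sphBall y r ∧ z ∈ halfSpace y r}

/-- The collection of all images under `Γ` of the balls with centre `x ∈ Ω(Γ)` and radius
`ε * dist (x, L(Γ))`. -/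
def ballCollection {n : ℕ} (Γ : Subgroup (Sph n ≃ₜ Sph n)) (ε : ℝ) : Set (Set (Sph n)) :=
  {D | ∃ γ ∈ Γ, ∃ x ∈ discontinuityDomain Γ, D = γ '' sphBall x (ε * sphInfDist x (limitSet Γ))}

/-- `G(Γ)`: the part in the open unit ball of the boundary of the union of the hyperbolic
half-spaces over the balls of the collection. -/
def invariantGraph {n : ℕ} (Γ : Subgroup (Sph n ≃ₜ Sph n)) (ε : ℝ) : Set (Euc n) :=
  frontier (⋃ D ∈ ballCollection Γ ε, halfSpaceOver D) ∩ unitBall n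

end KleinianGraph

end

namespace KleinianGraph

open Set Metric

/-! ### Round metric on the sphere: angles, chords and the distance to a set. -/

section Sphere

variable {n : ℕ}

/-! Write `d` for the distance to the limit set. The argument has three independent ingredients.

Distortion. Conformal maps preserve chordal cross ratios. Apply this to `x`, `y` and two limit
points whose images are a definite distance apart. A ball about `x` that is small relative to `d x`
then has an image that is small relative to `d` on that image, uniformly over the group
(`sphDist_apply_le`). Two distinct limit points at chordal distance `D` suffice, and the threshold
for ε is a multiple of `D`. Hence the balls of the collection form an `IsFineFamily`
(`isFineFamily_ballParameters`): they lie in Ω, their radii are at most an eighth of `d` at each of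
their points, and among them is the ball of radius `ε * d x` about every `x ∈ Ω`.

Radial geometry, with no group involved. On the ray through `x`, the half-space over a ball of small
radius `r` and centre `y` is given by `(1 + t ^ 2) * cos r < 2 * t * ⟪x, y⟫`. For `cos r > 0` this
persists as `t` increases to `1`, so the union meets each ray over Ω in a terminal segment and the
other rays not at all. The infimum `radialHeight` is the required function. The ball about `x`
itself gives `1 - f x ≥ ε * d x / 4`, and the radius bound gives `1 - f x ≤ d x / 8`. The Lipschitz
bound expresses that a dome of radius at most of order `d` has bounded slope at heights at least of
order `ε * d` (`radialHeight_le_add`).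

Invariance. Reflections extend to inversions or linear reflections of the ball, which are hyperbolic
isometries carrying half-spaces to half-spaces. Compositions inherit this, so the group preserves
the union and its frontier. -/

lemma norm_coe_sphere (x : Sph n) : ‖(x : Euc n)‖ = 1 := by
  simp

lemma cos_sphDist (x y : Sph n) : Real.cos (sphDist x y) = inner ℝ (x : Euc n) (y : Euc n) := by
  simp [sphDist, InnerProductGeometry.cos_angle]

lemma sphDist_nonneg (x y : Sph n) : 0 ≤ sphDist x y := InnerProductGeometry.angle_nonneg _ _

lemma sphDist_le_pi (x y : Sph n) : sphDist x y ≤ Real.pi := InnerProductGeometry.angle_le_pi _ _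

lemma sphDist_comm (x y : Sph n) : sphDist x y = sphDist y x := InnerProductGeometry.angle_comm _ _

lemma sphDist_self (x : Sph n) : sphDist x x = 0 :=
  InnerProductGeometry.angle_self (fun h => by simpa [h] using norm_coe_sphere x)

lemma sphDist_triangle (x y z : Sph n) : sphDist x z ≤ sphDist x y + sphDist y z :=
  InnerProductGeometry.angle_le_angle_add_angle _ _ _

lemma norm_sub_sq_eq (x y : Sph n) :
    ‖(x : Euc n) - y‖ ^ 2 = 2 * (1 - Real.cos (sphDist x y)) := by
  rw [norm_sub_sq_real, norm_coe_sphere, norm_coe_sphere, cos_sphDist]; ring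

lemma norm_sub_le_sphDist (x y : Sph n) : ‖(x : Euc n) - y‖ ≤ sphDist x y := by
  apply le_of_sq_le_sq _ (sphDist_nonneg x y)
  have := Real.one_sub_sq_div_two_le_cos (x := sphDist x y)
  rw [norm_sub_sq_eq]; linarith

/-- The constant is the Jordan-type bound `2 / π ^ 2` weakened by `π ≤ 4`. It makes angles at most
twice chords. -/
lemma one_sub_cos_ge {r : ℝ} (h0 : 0 ≤ r) (h1 : r ≤ Real.pi) : r ^ 2 / 8 ≤ 1 - Real.cos r := by
  have := Real.cos_le_one_sub_mul_cos_sq (x := r) (by rwa [abs_of_nonneg h0])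
  have h4 : Real.pi ^ 2 ≤ 16 := by nlinarith [Real.pi_le_four, Real.pi_pos]
  have h5 : (2 : ℝ) / 16 ≤ 2 / Real.pi ^ 2 := by gcongr
  nlinarith [sq_nonneg r]

lemma sphDist_le_two_mul_norm_sub (x y : Sph n) : sphDist x y ≤ 2 * ‖(x : Euc n) - y‖ := by
  apply le_of_sq_le_sq _ (by positivity)
  have := one_sub_cos_ge (sphDist_nonneg x y) (sphDist_le_pi x y)
  rw [mul_pow, norm_sub_sq_eq]; linarith

lemma mem_sphBall_iff {x y : Sph n} {r : ℝ} (h0 : 0 ≤ r) (h1 : r ≤ Real.pi) :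
    x ∈ sphBall y r ↔ Real.cos r < inner ℝ (x : Euc n) (y : Euc n) := by
  rw [← cos_sphDist]
  exact (Real.strictAntiOn_cos.lt_iff_gt ⟨h0, h1⟩
    ⟨sphDist_nonneg x y, sphDist_le_pi x y⟩).symm

lemma mem_sphBall_self (y : Sph n) {r : ℝ} (hr : 0 < r) : y ∈ sphBall y r := by
  simpa [sphBall, sphDist_self] using hr

/-- In positive dimension there are points at every distance in `[0, π]` from a given point. -/
lemma exists_sphDist_eq (hn : 1 ≤ n) (y : Sph n) {s : ℝ} (h0 : 0 ≤ s) (h1 : s ≤ Real.pi) :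
    ∃ x : Sph n, sphDist x y = s := by
  obtain ⟨u, hu, hu1⟩ : ∃ u : Euc n, inner ℝ (y : Euc n) u = 0 ∧ ‖u‖ = 1 := by
    have hfin : (Submodule.span ℝ {(y : Euc n)})ᗮ ≠ ⊥ := by
      intro h
      have h2 := Submodule.finrank_add_finrank_orthogonal (Submodule.span ℝ {(y : Euc n)})
      rw [h, finrank_bot] at h2
      have h3 := finrank_span_le_card (R := ℝ) ({(y : Euc n)} : Set (Euc n))
      simp at h2 h3
      omega
    obtain ⟨v, hv, hv0⟩ := Submodule.exists_mem_ne_zero_of_ne_bot hfin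
    have hv' := Submodule.mem_orthogonal_singleton_iff_inner_right.1 hv
    have : ‖v‖ ≠ 0 := by simpa using hv0
    exact ⟨‖v‖⁻¹ • v, by rw [inner_smul_right, hv', mul_zero], by
      rw [norm_smul, norm_inv, norm_norm, inv_mul_cancel₀ this]⟩
  have hn : ‖Real.cos s • (y : Euc n) + Real.sin s • u‖ = 1 := by
    have : ‖Real.cos s • (y : Euc n) + Real.sin s • u‖ ^ 2 = 1 := by
      rw [norm_add_sq_real, norm_smul, norm_smul, inner_smul_left, inner_smul_right, hu, hu1,
        norm_coe_sphere, mul_one, mul_one, Real.norm_eq_abs, Real.norm_eq_abs, sq_abs, sq_abs]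
      simp
    nlinarith [norm_nonneg (Real.cos s • (y : Euc n) + Real.sin s • u)]
  refine ⟨⟨Real.cos s • (y : Euc n) + Real.sin s • u, by simpa using hn⟩, ?_⟩
  apply Real.injOn_cos ⟨sphDist_nonneg _ _, sphDist_le_pi _ _⟩ ⟨h0, h1⟩
  rw [cos_sphDist]
  simp only [inner_add_left, inner_smul_left, real_inner_self_eq_norm_sq, norm_coe_sphere]
  rw [real_inner_comm, hu]
  simp

/-- The ball is the radial projection of the cone `cos r * ‖v‖ < ⟪y, v⟫`, which is convex because
`cos r ≥ 0`. -/
lemma isPreconnected_sphBall (y : Sph n) {r : ℝ} (h0 : 0 < r) (h1 : r ≤ Real.pi / 2) :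
    IsPreconnected (sphBall y r) := by
  have hc : 0 ≤ Real.cos r := Real.cos_nonneg_of_mem_Icc ⟨by linarith, h1⟩
  let S : Set (Euc n) := {v | v ∈ univ ∧ Real.cos r * ‖v‖ - inner ℝ (y : Euc n) v < 0}
  have hconv : Convex ℝ S := by
    apply ConvexOn.convex_lt
    have h2 : ConvexOn ℝ univ (fun v : Euc n => Real.cos r * ‖v‖) :=
      (convexOn_norm convex_univ).smul hc
    have h3 : ConcaveOn ℝ univ (fun v : Euc n => inner ℝ (y : Euc n) v) :=
      ((innerSL ℝ (y : Euc n)).toLinearMap).concaveOn convex_univ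
    exact h2.sub h3
  have hS : ∀ v : S, (v : Euc n) ≠ 0 := by
    rintro ⟨v, -, hv⟩ rfl
    simp at hv
  let φ : S → Sph n := fun v => ⟨‖(v : Euc n)‖⁻¹ • (v : Euc n), by
    have : ‖(v : Euc n)‖ ≠ 0 := by simpa using hS v
    rw [mem_sphere_zero_iff_norm, norm_smul, norm_inv, norm_norm, inv_mul_cancel₀ this]⟩
  have hφ : Continuous φ := by
    apply Continuous.subtype_mk
    exact (continuous_subtype_val.norm.inv₀ (fun v => by simpa using hS v)).smul
      continuous_subtype_val
  have himg : φ '' univ = sphBall y r := by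
    have hpi := Real.pi_pos
    ext x
    rw [mem_sphBall_iff h0.le (by linarith)]
    constructor
    · rintro ⟨⟨v, hv⟩, -, rfl⟩
      have h4 : 0 < ‖v‖ := by simpa using hS ⟨v, hv⟩
      have h5 := hv.2
      change _ < inner ℝ (‖v‖⁻¹ • v) (y : Euc n)
      rw [inner_smul_left, real_inner_comm]
      simp only [conj_trivial]
      rw [lt_inv_mul_iff₀ h4]; linarith
    · intro hx
      refine ⟨⟨x, mem_univ _, ?_⟩, mem_univ _, ?_⟩
      · rw [norm_coe_sphere, real_inner_comm]; linarith
      · apply Subtype.ext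
        simp [φ]
  rw [← himg]
  have : PreconnectedSpace S := isPreconnected_iff_preconnectedSpace.1 hconv.isPreconnected
  exact isPreconnected_univ.image φ hφ.continuousOn

section InfDist

variable {A : Set (Sph n)}

lemma bddBelow_sphDist (x : Sph n) (A : Set (Sph n)) :
    BddBelow (range fun a : A => sphDist x a) :=
  ⟨0, by rintro _ ⟨a, rfl⟩; exact sphDist_nonneg _ _⟩

lemma sphInfDist_le (x : Sph n) {a : Sph n} (ha : a ∈ A) : sphInfDist x A ≤ sphDist x a :=
  ciInf_le (bddBelow_sphDist x A) ⟨a, ha⟩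

lemma le_sphInfDist (hA : A.Nonempty) {x : Sph n} {b : ℝ} (h : ∀ a ∈ A, b ≤ sphDist x a) :
    b ≤ sphInfDist x A := by
  have := hA.to_subtype
  exact le_ciInf fun a => h a a.2

lemma sphInfDist_nonneg (x : Sph n) (A : Set (Sph n)) : 0 ≤ sphInfDist x A :=
  Real.iInf_nonneg fun _ => sphDist_nonneg _ _

lemma sphInfDist_le_pi (hA : A.Nonempty) (x : Sph n) : sphInfDist x A ≤ Real.pi :=
  (sphInfDist_le x hA.some_mem).trans (sphDist_le_pi _ _)

lemma sphInfDist_le_add (hA : A.Nonempty) (x y : Sph n) :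
    sphInfDist x A ≤ sphInfDist y A + sphDist x y := by
  rw [← sub_le_iff_le_add]
  refine le_sphInfDist hA fun a ha => ?_
  linarith [sphInfDist_le x ha, sphDist_triangle x y a]

lemma sphInfDist_pos (hA : A.Nonempty) (hcl : IsClosed A) {x : Sph n} (hx : x ∉ A) :
    0 < sphInfDist x A := by
  obtain ⟨δ, hδ, hball⟩ := Metric.isOpen_iff.1 hcl.isOpen_compl x hx
  refine lt_of_lt_of_le hδ (le_sphInfDist hA fun a ha => ?_)
  by_contra hlt
  refine hball (a := a) ?_ ha
  rw [mem_ball, Subtype.dist_eq, dist_comm, dist_eq_norm]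
  exact (norm_sub_le_sphDist x a).trans_lt (not_le.1 hlt)

/-- A spherical ball centred in an open set that does not reach the frontier of the set is
contained in it. -/
lemma sphBall_subset_of_le_sphInfDist {O : Set (Sph n)} (hO : IsOpen O) {x : Sph n} (hx : x ∈ O)
    {r : ℝ} (h0 : 0 < r) (h1 : r ≤ Real.pi / 2) (h2 : r ≤ sphInfDist x (frontier O)) :
    sphBall x r ⊆ O := by
  -- A connected set that meets `O` and contains no frontier point of `O` stays inside `O`.
  refine (isPreconnected_sphBall x h0 h1).subset_of_closure_inter_subset hO
    ⟨x, mem_sphBall_self x h0, hx⟩ ?_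
  rintro z ⟨hz, hzb⟩
  by_contra hzO
  have h3 : z ∈ frontier O := by rw [hO.frontier_eq]; exact ⟨hz, hzO⟩
  have h4 : sphDist z x < r := hzb
  have := sphInfDist_le x h3
  rw [sphDist_comm] at this
  linarith

end InfDist

end Sphere

/-! ### Extension of Möbius transformations to the ball, and conformal factors. -/

section Moebius

variable {n : ℕ}

/-- A Poincaré extension that maps half-spaces over spherical balls to the half-spaces over their
images. -/
structure IsMoebiusExtension (γ : Sph n ≃ₜ Sph n) (Φ : Euc n → Euc n) : Prop where
  poincare : IsPoincareExtension γ Φ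
  mapsHalfSpace : ∀ (y : Sph n) (r : ℝ), 0 < r → r < Real.pi → ∃ (y' : Sph n) (r' : ℝ),
    0 < r' ∧ r' < Real.pi ∧ γ '' sphBall y r = sphBall y' r' ∧
      MapsTo Φ (halfSpace y r) (halfSpace y' r')

lemma IsPoincareExtension.mapsTo_closedBall {γ : Sph n ≃ₜ Sph n} {Φ : Euc n → Euc n}
    (h : IsPoincareExtension γ Φ) : MapsTo Φ (closedBall 0 1) (closedBall 0 1) := by
  intro z hz
  rcases (mem_closedBall_zero_iff.1 hz).lt_or_eq with h1 | h1
  · exact ball_subset_closedBall (h.bijOn.mapsTo (mem_ball_zero_iff.2 h1))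
  · have := h.eq_on_sphere ⟨z, by simpa using h1⟩
    simp only at this
    rw [this]
    exact sphere_subset_closedBall (γ _).2

lemma IsPoincareExtension.comp {γ δ : Sph n ≃ₜ Sph n} {Φ Ψ : Euc n → Euc n}
    (h : IsPoincareExtension γ Φ) (h' : IsPoincareExtension δ Ψ) :
    IsPoincareExtension (γ * δ) (Φ ∘ Ψ) where
  continuousOn := h.continuousOn.comp h'.continuousOn h'.mapsTo_closedBall
  eq_on_sphere x := by simp [h'.eq_on_sphere, h.eq_on_sphere]
  bijOn := h.bijOn.comp h'.bijOn
  isometry z hz w hw := by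
    rw [Function.comp, Function.comp, h.isometry _ (h'.bijOn.mapsTo hz) _ (h'.bijOn.mapsTo hw),
      h'.isometry z hz w hw]

lemma IsMoebiusExtension.comp {γ δ : Sph n ≃ₜ Sph n} {Φ Ψ : Euc n → Euc n}
    (h : IsMoebiusExtension γ Φ) (h' : IsMoebiusExtension δ Ψ) :
    IsMoebiusExtension (γ * δ) (Φ ∘ Ψ) where
  poincare := h.poincare.comp h'.poincare
  mapsHalfSpace y r h0 h1 := by
    obtain ⟨y₁, r₁, h2, h3, h4, h5⟩ := h'.mapsHalfSpace y r h0 h1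
    obtain ⟨y₂, r₂, h6, h7, h8, h9⟩ := h.mapsHalfSpace y₁ r₁ h2 h3
    refine ⟨y₂, r₂, h6, h7, ?_, h9.comp h5⟩
    rw [← h8, ← h4, image_image]
    rfl

lemma isMoebiusExtension_one : IsMoebiusExtension (1 : Sph n ≃ₜ Sph n) id where
  poincare :=
    { continuousOn := continuousOn_id
      eq_on_sphere := fun _ => rfl
      bijOn := bijOn_id _
      isometry := fun _ _ _ _ => rfl }
  mapsHalfSpace y r h0 h1 := ⟨y, r, h0, h1, image_id _, mapsTo_id _⟩

/-- Every space-like inequality, `a ^ 2 < ‖v‖ ^ 2`, describes the side of a half-space. -/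
lemma exists_center_radius {v : Euc n} {a : ℝ} (h : a ^ 2 < ‖v‖ ^ 2) :
    ∃ (y : Sph n) (r : ℝ), 0 < r ∧ r < Real.pi ∧ ∀ z : Euc n,
      (1 + ‖z‖ ^ 2) * Real.cos r < 2 * inner ℝ z (y : Euc n) ↔
        (1 + ‖z‖ ^ 2) * a < 2 * inner ℝ z v := by
  have hv : 0 < ‖v‖ := by
    rcases (norm_nonneg v).eq_or_lt with h0 | h0
    · rw [← h0] at h; nlinarith [sq_nonneg a]
    · exact h0
  have habs := abs_lt.1 (abs_lt_of_sq_lt_sq h hv.le)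
  have h1 : -1 < a / ‖v‖ := by rw [lt_div_iff₀ hv]; linarith
  have h2 : a / ‖v‖ < 1 := by rw [div_lt_iff₀ hv]; linarith
  refine ⟨⟨‖v‖⁻¹ • v, ?_⟩, Real.arccos (a / ‖v‖), Real.arccos_pos.2 h2, ?_, fun z => ?_⟩
  · rw [mem_sphere_zero_iff_norm, norm_smul, norm_inv, norm_norm, inv_mul_cancel₀ hv.ne']
  · refine lt_of_le_of_ne (Real.arccos_le_pi _) fun h3 => ?_
    rw [Real.arccos_eq_pi] at h3
    linarith
  · rw [Real.cos_arccos h1.le h2.le]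
    simp only [inner_smul_right]
    rw [← mul_div_assoc, div_lt_iff₀ hv]
    have : 2 * (‖v‖⁻¹ * inner ℝ z v) * ‖v‖ = 2 * inner ℝ z v := by field_simp
    rw [this]

lemma mem_sphBall_iff_side {x y : Sph n} {r : ℝ} (h0 : 0 ≤ r) (h1 : r ≤ Real.pi) :
    x ∈ sphBall y r ↔
      (1 + ‖(x : Euc n)‖ ^ 2) * Real.cos r < 2 * inner ℝ (x : Euc n) (y : Euc n) := by
  rw [mem_sphBall_iff h0 h1, norm_coe_sphere]
  constructor <;> intro h <;> linarith

/-- A criterion for an involution of the closed ball to be a Möbius extension. -/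
lemma IsPoincareExtension.isMoebiusExtension_of_involution {φ : Sph n ≃ₜ Sph n}
    {Φ : Euc n → Euc n} (hP : IsPoincareExtension φ Φ)
    (hinv : ∀ z ∈ closedBall (0 : Euc n) 1, Φ (Φ z) = z)
    (hside : ∀ (y : Sph n) (r : ℝ), 0 < r → r < Real.pi → ∃ (v : Euc n) (a : ℝ),
      a ^ 2 < ‖v‖ ^ 2 ∧ ∀ z ∈ closedBall (0 : Euc n) 1,
        ((1 + ‖Φ z‖ ^ 2) * Real.cos r < 2 * inner ℝ (Φ z) (y : Euc n) ↔
          (1 + ‖z‖ ^ 2) * a < 2 * inner ℝ z v)) :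
    IsMoebiusExtension φ Φ where
  poincare := hP
  mapsHalfSpace y r h0 h1 := by
    obtain ⟨v, a, hva, hz⟩ := hside y r h0 h1
    obtain ⟨y', r', h2, h3, h4⟩ := exists_center_radius hva
    -- The hypothesis describes a preimage under `Φ`; for an involution it is also the image.
    -- Including the sphere in the closed ball treats spherical balls and half-spaces at once.
    have key : ∀ z ∈ closedBall (0 : Euc n) 1,
        ((1 + ‖z‖ ^ 2) * Real.cos r < 2 * inner ℝ z (y : Euc n) ↔
          (1 + ‖Φ z‖ ^ 2) * Real.cos r' < 2 * inner ℝ (Φ z) (y' : Euc n)) := fun z hzb => by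
      rw [h4, ← hz _ (hP.mapsTo_closedBall hzb), hinv z hzb]
    refine ⟨y', r', h2, h3, ?_, ?_⟩
    · ext x
      constructor
      · rintro ⟨x, hx, rfl⟩
        rw [mem_sphBall_iff_side h0.le h1.le, key _ (sphere_subset_closedBall x.2),
          hP.eq_on_sphere] at hx
        rwa [mem_sphBall_iff_side h2.le h3.le]
      · intro hx
        refine ⟨φ.symm x, ?_, by simp⟩
        rw [mem_sphBall_iff_side h0.le h1.le, key _ (sphere_subset_closedBall (φ.symm x).2),
          hP.eq_on_sphere]
        simpa using (mem_sphBall_iff_side h2.le h3.le).1 hx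
    · rintro z ⟨hzb, hlt⟩
      exact ⟨hP.bijOn.mapsTo hzb, (key z (ball_subset_closedBall hzb)).1 hlt⟩

section Inversion

open EuclideanGeometry

variable {c : Euc n} {R : ℝ}

lemma norm_sub_center_pos (hc : 1 < ‖c‖) {z : Euc n} (hz : ‖z‖ ≤ 1) : 0 < ‖z - c‖ := by
  rw [norm_sub_rev]
  linarith [norm_sub_norm_le c z]

lemma norm_sub_center_sq (z : Euc n) : ‖z - c‖ ^ 2 = ‖z‖ ^ 2 - 2 * inner ℝ z c + ‖c‖ ^ 2 :=
  norm_sub_sq_real z c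

lemma inversion_eq (z : Euc n) :
    inversion c R z = (R ^ 2 / ‖z - c‖ ^ 2) • (z - c) + c := by
  simp [inversion, dist_eq_norm, div_pow]

lemma norm_sub_sq_mul_inner_inversion (hc : 1 < ‖c‖) (hR : R ^ 2 = ‖c‖ ^ 2 - 1) {z : Euc n}
    (hz : ‖z‖ ≤ 1) (v : Euc n) :
    ‖z - c‖ ^ 2 * inner ℝ (inversion c R z) v =
      (‖c‖ ^ 2 - 1) * (inner ℝ z v - inner ℝ c v) + ‖z - c‖ ^ 2 * inner ℝ c v := by
  have h := norm_sub_center_pos hc hz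
  rw [inversion_eq, inner_add_left, inner_smul_left, inner_sub_left, ← hR]
  simp only [conj_trivial]
  field_simp

/-- This is where orthogonality to the unit sphere enters. The factor `R ^ 2 / ‖z - c‖ ^ 2` by which
`1 - ‖z‖ ^ 2` scales is the one that cancels in the hyperbolic distance. -/
lemma norm_sub_sq_mul_norm_inversion_sq (hc : 1 < ‖c‖) (hR : R ^ 2 = ‖c‖ ^ 2 - 1) {z : Euc n}
    (hz : ‖z‖ ≤ 1) :
    ‖z - c‖ ^ 2 * (1 - ‖inversion c R z‖ ^ 2) = R ^ 2 * (1 - ‖z‖ ^ 2) := by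
  have h := norm_sub_center_pos hc hz
  have h1 : ‖z - c‖ ^ 2 * ‖inversion c R z‖ ^ 2 =
      R ^ 4 + 2 * R ^ 2 * (inner ℝ z c - ‖c‖ ^ 2) + ‖z - c‖ ^ 2 * ‖c‖ ^ 2 := by
    rw [inversion_eq, norm_add_sq_real, norm_smul, inner_smul_left, inner_sub_left,
      real_inner_self_eq_norm_sq, Real.norm_eq_abs, abs_of_nonneg (by positivity)]
    simp only [conj_trivial]
    field_simp
  have h2 := norm_sub_center_sq (c := c) z
  have h3 : R ^ 4 = R ^ 2 * R ^ 2 := by ring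
  rw [mul_sub, h1, h3, h2, hR]
  ring

lemma inversion_mem_unitBall (hc : 1 < ‖c‖) (hR : R ^ 2 = ‖c‖ ^ 2 - 1) {z : Euc n}
    (hz : z ∈ unitBall n) : inversion c R z ∈ unitBall n := by
  have hz' : ‖z‖ < 1 := mem_ball_zero_iff.1 hz
  refine mem_ball_zero_iff.2 ?_
  have h1 := norm_sub_sq_mul_norm_inversion_sq hc hR hz'.le
  have h2 := norm_sub_center_pos hc hz'.le
  have h3 : 0 < R ^ 2 * (1 - ‖z‖ ^ 2) := by
    apply mul_pos <;> nlinarith [norm_nonneg z]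
  rw [← h1] at h3
  have := pos_of_mul_pos_right h3 (by positivity)
  nlinarith [norm_nonneg (inversion c R z)]

lemma isMoebiusExtension_inversion (hc : 1 < ‖c‖) (hR : R ^ 2 = ‖c‖ ^ 2 - 1)
    {φ : Sph n ≃ₜ Sph n} (hφ : ∀ x : Sph n, (φ x : Euc n) = inversion c R (x : Euc n)) :
    IsMoebiusExtension φ (inversion c R) := by
  have hR0 : R ≠ 0 := by rintro rfl; nlinarith
  have hP : IsPoincareExtension φ (inversion c R) := by
    refine ⟨?_, fun x => (hφ x).symm, ?_, ?_⟩
    · refine ContinuousOn.inversion continuousOn_const continuousOn_const continuousOn_id ?_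
      intro z hz h
      have := norm_sub_center_pos hc (mem_closedBall_zero_iff.1 hz)
      change z = c at h
      simp [h] at this
    · refine ⟨fun z hz => inversion_mem_unitBall hc hR hz,
        (inversion_injective c hR0).injOn, fun z hz => ?_⟩
      exact ⟨_, inversion_mem_unitBall hc hR hz, inversion_inversion c hR0 z⟩
    · intro z hz w hw
      have hz' : ‖z‖ < 1 := mem_ball_zero_iff.1 hz
      have hw' : ‖w‖ < 1 := mem_ball_zero_iff.1 hw
      have hzc := norm_sub_center_pos hc hz'.le
      have hwc := norm_sub_center_pos hc hw'.le
      have h1 := norm_sub_sq_mul_norm_inversion_sq hc hR hz'.le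
      have h2 := norm_sub_sq_mul_norm_inversion_sq hc hR hw'.le
      have h3 := dist_inversion_inversion (sub_ne_zero.1 (norm_pos_iff.1 hzc))
        (sub_ne_zero.1 (norm_pos_iff.1 hwc)) R
      rw [dist_eq_norm, dist_eq_norm, dist_eq_norm, dist_eq_norm] at h3
      have h4 : (1 - ‖inversion c R z‖ ^ 2) * (1 - ‖inversion c R w‖ ^ 2) =
          (R ^ 2 / (‖z - c‖ * ‖w - c‖)) ^ 2 * ((1 - ‖z‖ ^ 2) * (1 - ‖w‖ ^ 2)) := by
        field_simp
        calc _ = (‖z - c‖ ^ 2 * (1 - ‖inversion c R z‖ ^ 2)) *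
              (‖w - c‖ ^ 2 * (1 - ‖inversion c R w‖ ^ 2)) := by ring
          _ = _ := by
            rw [h1, h2]; ring
      have h5 : 0 < R ^ 2 / (‖z - c‖ * ‖w - c‖) := by positivity
      rw [hypDist, hypDist, h3, h4, Real.sqrt_mul (by positivity), Real.sqrt_sq h5.le,
        mul_div_mul_left _ _ h5.ne']
  refine hP.isMoebiusExtension_of_involution (fun z _ => inversion_inversion c hR0 z) ?_
  intro y r h0 h1
  -- Multiplying the half-space inequality at the inverted point by `‖z - c‖ ^ 2` and collecting
  -- terms gives this `v` and `a`. They satisfy `‖v‖ ^ 2 - a ^ 2 = (‖c‖ ^ 2 - 1) ^ 2 * (1 - cos r ^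
  -- 2)`.
  refine ⟨(‖c‖ ^ 2 - 1) • (y : Euc n) + (2 * (Real.cos r - inner ℝ c (y : Euc n))) • c,
    Real.cos r * (1 + ‖c‖ ^ 2) - 2 * inner ℝ c (y : Euc n), ?_, ?_⟩
  · have h2 : Real.cos r ^ 2 < 1 := by
      have := Real.sin_pos_of_pos_of_lt_pi h0 h1
      nlinarith [Real.sin_sq_add_cos_sq r]
    rw [norm_add_sq_real, norm_smul, norm_smul, inner_smul_left, inner_smul_right,
      norm_coe_sphere, real_inner_comm, mul_pow, mul_pow, Real.norm_eq_abs, Real.norm_eq_abs,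
      sq_abs, sq_abs]
    simp only [conj_trivial]
    have h3 : 0 < (‖c‖ ^ 2 - 1) ^ 2 * (1 - Real.cos r ^ 2) := by
      have h4 : 0 < ‖c‖ ^ 2 - 1 := by nlinarith
      exact mul_pos (by positivity) (by linarith)
    nlinarith
  · intro z hz
    have hz' : ‖z‖ ≤ 1 := mem_closedBall_zero_iff.1 hz
    have hq : 0 < ‖z - c‖ ^ 2 := by have := norm_sub_center_pos hc hz'; positivity
    have e1 := norm_sub_sq_mul_inner_inversion hc hR hz' (y : Euc n)
    have e2 := norm_sub_sq_mul_norm_inversion_sq hc hR hz'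
    have e3 := norm_sub_center_sq (c := c) z
    rw [← mul_lt_mul_iff_right₀ hq, inner_add_right, inner_smul_right, inner_smul_right]
    have e4 : ‖z - c‖ ^ 2 * ((1 + ‖inversion c R z‖ ^ 2) * Real.cos r) =
        ((1 + ‖c‖ ^ 2) * (1 + ‖z‖ ^ 2) - 4 * inner ℝ z c) * Real.cos r := by
      rw [hR] at e2
      linear_combination (2 * e3 - e2) * Real.cos r
    have e5 : ‖z - c‖ ^ 2 * (2 * inner ℝ (inversion c R z) (y : Euc n)) =
        2 * inner ℝ c (y : Euc n) * (1 + ‖z‖ ^ 2) - 4 * inner ℝ c (y : Euc n) * inner ℝ z c +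
          2 * (‖c‖ ^ 2 - 1) * inner ℝ z (y : Euc n) := by
      linear_combination 2 * e1 + 2 * inner ℝ c (y : Euc n) * e3
    rw [e4, e5]
    constructor <;> intro h <;> linarith

end Inversion

lemma isMoebiusExtension_linearIsometry (ρ : Euc n ≃ₗᵢ[ℝ] Euc n) (hρ : ∀ z, ρ (ρ z) = z)
    {φ : Sph n ≃ₜ Sph n} (hφ : ∀ x : Sph n, (φ x : Euc n) = ρ (x : Euc n)) :
    IsMoebiusExtension φ ρ := by
  have hmaps : ∀ z ∈ unitBall n, ρ z ∈ unitBall n := fun z hz => by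
    simpa [unitBall] using hz
  have hP : IsPoincareExtension φ ρ := by
    refine ⟨ρ.continuous.continuousOn, fun x => (hφ x).symm,
      ⟨hmaps, ρ.injective.injOn, fun z hz => ⟨ρ z, hmaps z hz, hρ z⟩⟩, fun z _ w _ => ?_⟩
    rw [hypDist, hypDist, ← map_sub, ρ.norm_map, ρ.norm_map, ρ.norm_map]
  refine hP.isMoebiusExtension_of_involution (fun z _ => hρ z) fun y r h0 h1 => ?_
  refine ⟨ρ y, Real.cos r, ?_, fun z _ => ?_⟩
  · rw [ρ.norm_map, norm_coe_sphere]
    have := Real.sin_pos_of_pos_of_lt_pi h0 h1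
    nlinarith [Real.sin_sq_add_cos_sq r]
  · rw [ρ.norm_map, ← ρ.inner_map_map z (ρ y), hρ]

lemma IsSphereReflection.exists_extension {φ : Sph n ≃ₜ Sph n} (h : IsSphereReflection φ) :
    ∃ Φ : Euc n → Euc n, IsMoebiusExtension φ Φ ∧ ∀ z, Φ (Φ z) = z := by
  rcases h with ⟨c, R, hc, hR, hφ⟩ | ⟨v, -, hφ⟩
  · exact ⟨_, isMoebiusExtension_inversion hc hR hφ,
      EuclideanGeometry.inversion_inversion c (by rintro rfl; nlinarith)⟩
  · exact ⟨_, isMoebiusExtension_linearIsometry _ (Submodule.reflection_reflection _) hφ,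
      Submodule.reflection_reflection _⟩

lemma IsSphereReflection.inv_eq {φ : Sph n ≃ₜ Sph n} (h : IsSphereReflection φ) : φ⁻¹ = φ := by
  obtain ⟨Φ, hΦ, hinv⟩ := h.exists_extension
  rw [inv_eq_iff_mul_eq_one]
  ext1 x
  apply Subtype.ext
  change ((φ (φ x) : Sph n) : Euc n) = x
  rw [← hΦ.poincare.eq_on_sphere, ← hΦ.poincare.eq_on_sphere, hinv]

/-- Every conformal transformation and its inverse have mutually inverse Möbius extensions. -/
lemma exists_extension_of_mem_conformalGroup {γ : Sph n ≃ₜ Sph n} (hγ : γ ∈ conformalGroup n) :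
    ∃ Φ Ψ : Euc n → Euc n, IsMoebiusExtension γ Φ ∧ IsMoebiusExtension γ⁻¹ Ψ ∧
      (∀ z, Ψ (Φ z) = z) ∧ ∀ z, Φ (Ψ z) = z := by
  induction hγ using Subgroup.closure_induction with
  | mem φ h =>
    obtain ⟨Φ, hΦ, hinv⟩ := IsSphereReflection.exists_extension h
    exact ⟨Φ, Φ, hΦ, by rwa [IsSphereReflection.inv_eq h], hinv, hinv⟩
  | one => exact ⟨id, id, isMoebiusExtension_one, by simpa using isMoebiusExtension_one,
      fun _ => rfl, fun _ => rfl⟩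
  | mul a b _ _ ha hb =>
    obtain ⟨Φ, Ψ, h1, h2, h3, h4⟩ := ha
    obtain ⟨Φ', Ψ', h1', h2', h3', h4'⟩ := hb
    refine ⟨Φ ∘ Φ', Ψ' ∘ Ψ, h1.comp h1', ?_, fun z => by simp [h3, h3'],
      fun z => by simp [h4, h4']⟩
    rw [mul_inv_rev]
    exact h2'.comp h2
  | inv a _ ha =>
    obtain ⟨Φ, Ψ, h1, h2, h3, h4⟩ := ha
    exact ⟨Ψ, Φ, h2, by rwa [inv_inv], h4, h3⟩

/-- An inversion has factor `|R| / ‖x - c‖`, a linear reflection has factor `1`. The product form is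
what makes cross ratios invariant. -/
lemma IsSphereReflection.exists_conformal_factor {φ : Sph n ≃ₜ Sph n} (h : IsSphereReflection φ) :
    ∃ l : Sph n → ℝ, (∀ x, 0 < l x) ∧ ∀ x y : Sph n,
      ‖(φ x : Euc n) - φ y‖ = l x * l y * ‖(x : Euc n) - y‖ := by
  rcases h with ⟨c, R, hc, hR, hφ⟩ | ⟨v, -, hφ⟩
  · have hpos : ∀ x : Sph n, 0 < ‖(x : Euc n) - c‖ := fun x =>
      norm_sub_center_pos hc (norm_coe_sphere x).le
    have hR0 : R ≠ 0 := by rintro rfl; nlinarith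
    refine ⟨fun x => |R| / ‖(x : Euc n) - c‖,
      fun x => div_pos (abs_pos.2 hR0) (hpos x), fun x y => ?_⟩
    have := EuclideanGeometry.dist_inversion_inversion (sub_ne_zero.1 (norm_pos_iff.1 (hpos x)))
      (sub_ne_zero.1 (norm_pos_iff.1 (hpos y))) R
    rw [dist_eq_norm, dist_eq_norm, dist_eq_norm, dist_eq_norm] at this
    rw [hφ, hφ, this, div_mul_div_comm, abs_mul_abs_self, sq]
  · refine ⟨fun _ => 1, fun _ => one_pos, fun x y => ?_⟩
    rw [hφ, hφ, ← map_sub, LinearIsometryEquiv.norm_map]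
    ring

/-- Conformal transformations multiply chordal distances by a product of conformal factors. -/
lemma exists_conformal_factor {γ : Sph n ≃ₜ Sph n} (hγ : γ ∈ conformalGroup n) :
    ∃ l : Sph n → ℝ, (∀ x, 0 < l x) ∧ ∀ x y : Sph n,
      ‖(γ x : Euc n) - γ y‖ = l x * l y * ‖(x : Euc n) - y‖ := by
  induction hγ using Subgroup.closure_induction with
  | mem φ h => exact IsSphereReflection.exists_conformal_factor h
  | one => exact ⟨fun _ => 1, fun _ => one_pos, fun x y => by simp⟩
  | mul a b _ _ ha hb =>
    obtain ⟨l, hl, h⟩ := ha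
    obtain ⟨l', hl', h'⟩ := hb
    refine ⟨fun x => l (b x) * l' x, fun x => mul_pos (hl _) (hl' _), fun x y => ?_⟩
    change ‖(a (b x) : Euc n) - a (b y)‖ = _
    rw [h, h']
    ring
  | inv a _ ha =>
    obtain ⟨l, hl, h⟩ := ha
    refine ⟨fun x => (l (a.symm x))⁻¹, fun x => inv_pos.2 (hl _), fun x y => ?_⟩
    change ‖(a.symm x : Euc n) - a.symm y‖ = _
    have h1 := h (a.symm x) (a.symm y)
    rw [a.apply_symm_apply, a.apply_symm_apply] at h1
    have h2 := hl (a.symm x)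
    have h3 := hl (a.symm y)
    rw [h1]
    field_simp

end Moebius

/-! ### Unions of half-spaces over small balls as radial graphs. -/

section RadialGraph

variable {n : ℕ}

/-- The union of the half-spaces with given centres and radii. -/
def halfSpaceUnion (P : Set (Sph n × ℝ)) : Set (Euc n) := ⋃ p ∈ P, halfSpace p.1 p.2

lemma mem_halfSpaceUnion {P : Set (Sph n × ℝ)} {z : Euc n} :
    z ∈ halfSpaceUnion P ↔ ∃ p ∈ P, z ∈ halfSpace p.1 p.2 := by
  simp only [halfSpaceUnion, mem_iUnion, exists_prop]

lemma isOpen_halfSpace (y : Sph n) (r : ℝ) : IsOpen (halfSpace y r) := by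
  have h : IsOpen {z : Euc n | (1 + ‖z‖ ^ 2) * Real.cos r < 2 * inner ℝ z (y : Euc n)} :=
    isOpen_lt (by fun_prop) (by fun_prop)
  exact isOpen_ball.inter h

lemma isOpen_halfSpaceUnion (P : Set (Sph n × ℝ)) : IsOpen (halfSpaceUnion P) :=
  isOpen_biUnion fun p _ => isOpen_halfSpace p.1 p.2

lemma halfSpaceUnion_subset (P : Set (Sph n × ℝ)) : halfSpaceUnion P ⊆ unitBall n :=
  iUnion₂_subset fun _ _ _ hz => hz.1

lemma norm_smul_coe {t : ℝ} (h0 : 0 ≤ t) (x : Sph n) : ‖t • (x : Euc n)‖ = t := by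
  rw [norm_smul, norm_coe_sphere, mul_one, Real.norm_of_nonneg h0]

lemma smul_mem_halfSpace_iff {x y : Sph n} {t r : ℝ} (h0 : 0 ≤ t) :
    t • (x : Euc n) ∈ halfSpace y r ↔
      t < 1 ∧ (1 + t ^ 2) * Real.cos r < 2 * t * inner ℝ (x : Euc n) (y : Euc n) := by
  rw [halfSpace, mem_ofPred_eq, unitBall, mem_ball_zero_iff, norm_smul_coe h0, inner_smul_left]
  simp [mul_assoc]

/-- A collection of spherical balls (given by centres and radii) that are contained in `O` and
small compared with the function `d` on them, and contain the balls of radius `ε * d x`. -/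
structure IsFineFamily (O : Set (Sph n)) (d : Sph n → ℝ) (ε : ℝ) (P : Set (Sph n × ℝ)) : Prop where
  eps_pos : 0 < ε
  eps_le : ε ≤ 1
  le_add : ∀ x y, d x ≤ d y + sphDist x y
  le_pi : ∀ x, d x ≤ Real.pi
  pos : ∀ x ∈ O, 0 < d x
  radius_pos : ∀ p ∈ P, 0 < p.2
  subset : ∀ p ∈ P, sphBall p.1 p.2 ⊆ O
  radius_le : ∀ p ∈ P, ∀ w ∈ sphBall p.1 p.2, p.2 ≤ d w / 8
  mem : ∀ x ∈ O, (x, ε * d x) ∈ P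

/-- The radial height of the union of half-spaces. -/
noncomputable def radialHeight (P : Set (Sph n × ℝ)) (x : Sph n) : ℝ :=
  sInf {t : ℝ | 0 < t ∧ t < 1 ∧ t • (x : Euc n) ∈ halfSpaceUnion P}

namespace IsFineFamily

variable {O : Set (Sph n)} {d : Sph n → ℝ} {ε : ℝ} {P : Set (Sph n × ℝ)}

lemma radius_le_half (h : IsFineFamily O d ε P) {p : Sph n × ℝ} (hp : p ∈ P) : p.2 ≤ 1 / 2 := by
  have := h.radius_le p hp p.1 (mem_sphBall_self _ (h.radius_pos p hp))
  linarith [h.le_pi p.1, Real.pi_le_four]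

lemma half_le_cos (h : IsFineFamily O d ε P) {p : Sph n × ℝ} (hp : p ∈ P) :
    1 / 2 ≤ Real.cos p.2 := by
  have := Real.one_sub_sq_div_two_le_cos (x := p.2)
  nlinarith [h.radius_le_half hp, h.radius_pos p hp]

/-- Since `1 + t ^ 2 ≥ 2 * t`, the half-space inequality forces `cos r < ⟪x, y⟫`. Since `⟪x, y⟫ ≤ 1`
and `cos r ≥ 1 - r ^ 2 / 2`, it also forces `(1 - t) ^ 2 < r ^ 2`. -/
lemma of_smul_mem (h : IsFineFamily O d ε P) {p : Sph n × ℝ} (hp : p ∈ P) {x : Sph n} {t : ℝ}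
    (h0 : 0 ≤ t) (ht : t • (x : Euc n) ∈ halfSpace p.1 p.2) :
    x ∈ sphBall p.1 p.2 ∧ 1 - t < p.2 := by
  have hr := h.radius_pos p hp
  have hr' := h.radius_le_half hp
  have hc := h.half_le_cos hp
  obtain ⟨h1, h2⟩ := (smul_mem_halfSpace_iff h0).1 ht
  have hin : inner ℝ (x : Euc n) (p.1 : Euc n) ≤ 1 := by
    rw [← cos_sphDist]; exact Real.cos_le_one _
  have h3 : 0 < t := by
    rcases h0.eq_or_lt with rfl | h3
    · norm_num at h2; linarith
    · exact h3
  constructor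
  · rw [mem_sphBall_iff hr.le (by linarith [Real.pi_gt_three])]
    by_contra hcon
    nlinarith [mul_le_mul_of_nonneg_left (not_lt.1 hcon) h3.le, sq_nonneg (1 - t)]
  · have := Real.one_sub_sq_div_two_le_cos (x := p.2)
    have h4 : (1 + t ^ 2) * Real.cos p.2 < 2 * t := by nlinarith
    have h6 : (1 + t ^ 2) * (1 - p.2 ^ 2 / 2) < 2 * t :=
      lt_of_le_of_lt (mul_le_mul_of_nonneg_left this (by positivity)) h4
    have h7 : t ^ 2 * p.2 ^ 2 ≤ 1 * p.2 ^ 2 := by gcongr; nlinarith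
    have h5 : (1 - t) ^ 2 < p.2 ^ 2 := by nlinarith
    exact lt_of_pow_lt_pow_left₀ 2 hr.le h5

lemma smul_mem_of_le (h : IsFineFamily O d ε P) {x : Sph n} {t s : ℝ} (h0 : 0 ≤ t) (hts : t ≤ s)
    (hs : s < 1) (ht : t • (x : Euc n) ∈ halfSpaceUnion P) :
    s • (x : Euc n) ∈ halfSpaceUnion P := by
  obtain ⟨p, hp, hz⟩ := mem_halfSpaceUnion.1 ht
  refine mem_halfSpaceUnion.2 ⟨p, hp, (smul_mem_halfSpace_iff (h0.trans hts)).2 ⟨hs, ?_⟩⟩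
  have h1 := (of_smul_mem h hp h0 hz).2
  have h2 := h.radius_le_half hp
  have h3 := h.half_le_cos hp
  have h4 := ((smul_mem_halfSpace_iff h0).1 hz).2
  have h5 : 0 < t := by linarith
  -- Monotonicity along the ray rests on `s * (1 + t ^ 2) - t * (1 + s ^ 2) = (s - t) * (1 - s *
  -- t)`.
  have h7 : 0 ≤ (s - t) * (1 - s * t) * Real.cos p.2 := by
    apply mul_nonneg (mul_nonneg _ _) <;> nlinarith
  have h6 := mul_lt_mul_of_pos_left h4 (h5.trans_le hts)
  refine lt_of_mul_lt_mul_left (a := t) ?_ h5.le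
  linarith

/-- The half-space over the ball of radius `r = ε * d x` about `x` contains the point: the condition
is `(1 - t) ^ 2 < (1 + t ^ 2) * (1 - cos r)`, and `1 - cos r ≥ r ^ 2 / 8`. -/
lemma smul_mem_of_one_sub_le (h : IsFineFamily O d ε P) {x : Sph n} (hx : x ∈ O) {t : ℝ}
    (ht1 : t < 1) (ht : 1 - t ≤ ε * d x / 4) : t • (x : Euc n) ∈ halfSpaceUnion P := by
  have hp := h.mem x hx
  have h1 := h.radius_pos _ hp
  have h2 := h.radius_le_half hp
  simp only at h1 h2
  refine mem_halfSpaceUnion.2 ⟨_, hp, (smul_mem_halfSpace_iff (by linarith)).2 ⟨ht1, ?_⟩⟩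
  simp only [real_inner_self_eq_norm_sq, norm_coe_sphere]
  have h3 := one_sub_cos_ge h1.le (by linarith [Real.pi_gt_three])
  set r := ε * d x
  have h4 : (1 - t) ^ 2 ≤ (r / 4) ^ 2 := by gcongr
  have h5 : (1 + t ^ 2) * (r ^ 2 / 8) ≤ (1 + t ^ 2) * (1 - Real.cos r) := by gcongr
  have h6 : 0 < r ^ 2 := by positivity
  nlinarith

/-- A union of infinitely many half-spaces could accumulate at lower points of the ray. The
monotonicity gap `(s - t) * (1 - s * t) * cos r` prevents this, being bounded below uniformly
because `cos r ≥ 1 / 2`. -/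
lemma smul_notMem_closure (h : IsFineFamily O d ε P) {x : Sph n} {t s : ℝ} (h0 : 0 ≤ t)
    (hts : t < s) (hs : s < 1) (hsx : s • (x : Euc n) ∉ halfSpaceUnion P) :
    t • (x : Euc n) ∉ closure (halfSpaceUnion P) := by
  intro hcl
  set η := (s - t) * (1 - s * t) / 2 with hη
  have hη0 : 0 < η := by
    have : 0 < 1 - s * t := by nlinarith
    have : 0 < s - t := by linarith
    positivity
  obtain ⟨z, hz, hd⟩ := Metric.mem_closure_iff.1 hcl (η / 4) (by positivity)
  obtain ⟨p, hp, hzb, hz⟩ := mem_halfSpaceUnion.1 hz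
  have hz1 : ‖z‖ < 1 := mem_ball_zero_iff.1 hzb
  have hc := h.half_le_cos hp
  have hsp : 2 * s * inner ℝ (x : Euc n) (p.1 : Euc n) ≤ (1 + s ^ 2) * Real.cos p.2 := by
    by_contra hcon
    exact hsx (mem_halfSpaceUnion.2 ⟨p, hp,
      (smul_mem_halfSpace_iff (h0.trans hts.le)).2 ⟨hs, not_le.1 hcon⟩⟩)
  have e1 : |‖t • (x : Euc n)‖ - ‖z‖| ≤ η / 4 :=
    (abs_norm_sub_norm_le _ _).trans (by rw [← dist_eq_norm]; exact hd.le)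
  rw [norm_smul_coe h0] at e1
  have e2 : |inner ℝ (t • (x : Euc n) - z) (p.1 : Euc n)| ≤ η / 4 := by
    refine (abs_real_inner_le_norm _ _).trans ?_
    rw [norm_coe_sphere, mul_one, ← dist_eq_norm]
    exact hd.le
  rw [inner_sub_left, inner_smul_left] at e2
  simp only [conj_trivial] at e2
  have e3 := (abs_le.1 e1)
  have e4 := (abs_le.1 e2)
  have e5 : (1 + t ^ 2) * Real.cos p.2 - η ≤ 2 * (t * inner ℝ (x : Euc n) (p.1 : Euc n)) := by
    have h1 : t ^ 2 - ‖z‖ ^ 2 ≤ η / 2 := by nlinarith [norm_nonneg z]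
    have h2 : (t ^ 2 - ‖z‖ ^ 2) * Real.cos p.2 ≤ η / 2 := by
      nlinarith [Real.cos_le_one p.2]
    linarith
  have e6 : s * η < η := by nlinarith
  have e7 : 2 * η * (1 / 2) ≤ 2 * η * Real.cos p.2 := by gcongr
  have e8 := mul_le_mul_of_nonneg_left e5 (h0.trans hts.le)
  have e9 := mul_le_mul_of_nonneg_left hsp h0
  have e10 : s * (1 + t ^ 2) * Real.cos p.2 - t * (1 + s ^ 2) * Real.cos p.2 =
      2 * η * Real.cos p.2 := by rw [hη]; ring
  linarith

lemma mem_of_smul_mem (h : IsFineFamily O d ε P) {x : Sph n} {t : ℝ} (h0 : 0 ≤ t)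
    (ht : t • (x : Euc n) ∈ halfSpaceUnion P) : x ∈ O ∧ 1 - t < d x / 8 ∧ 1 / 2 < t := by
  obtain ⟨p, hp, hz⟩ := mem_halfSpaceUnion.1 ht
  obtain ⟨h1, h2⟩ := of_smul_mem h hp h0 hz
  exact ⟨h.subset p hp h1, h2.trans_le (h.radius_le p hp x h1), by
    linarith [h.radius_le_half hp]⟩

lemma bddBelow_heights (x : Sph n) :
    BddBelow {t : ℝ | 0 < t ∧ t < 1 ∧ t • (x : Euc n) ∈ halfSpaceUnion P} :=
  ⟨0, fun _ ht => ht.1.le⟩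

lemma radialHeight_le (h : IsFineFamily O d ε P) {x : Sph n} (hx : x ∈ O) :
    radialHeight P x ≤ 1 - ε * d x / 4 := by
  have h1 := mul_pos h.eps_pos (h.pos x hx)
  have h2 : ε * d x ≤ 1 * Real.pi := mul_le_mul h.eps_le (h.le_pi x) (h.pos x hx).le zero_le_one
  have h3 := Real.pi_lt_four
  exact csInf_le (bddBelow_heights x)
    ⟨by linarith, by linarith, h.smul_mem_of_one_sub_le hx (by linarith) (by linarith)⟩

lemma radialHeight_lt_one (h : IsFineFamily O d ε P) {x : Sph n} (hx : x ∈ O) :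
    radialHeight P x < 1 := by
  linarith [h.radialHeight_le hx, mul_pos h.eps_pos (h.pos x hx)]

lemma heights_nonempty (h : IsFineFamily O d ε P) {x : Sph n} (hx : x ∈ O) :
    {t : ℝ | 0 < t ∧ t < 1 ∧ t • (x : Euc n) ∈ halfSpaceUnion P}.Nonempty := by
  by_contra hcon
  have h1 := mul_pos h.eps_pos (h.pos x hx)
  have h2 : ε * d x ≤ 1 * Real.pi := mul_le_mul h.eps_le (h.le_pi x) (h.pos x hx).le zero_le_one
  have h3 := Real.pi_lt_four
  exact hcon ⟨1 - ε * d x / 4, by linarith, by linarith,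
    h.smul_mem_of_one_sub_le hx (by linarith) (by linarith)⟩

lemma half_le_radialHeight (h : IsFineFamily O d ε P) {x : Sph n} (hx : x ∈ O) :
    1 / 2 ≤ radialHeight P x :=
  le_csInf (h.heights_nonempty hx) fun _ ht => (h.mem_of_smul_mem ht.1.le ht.2.2).2.2.le

lemma le_radialHeight (h : IsFineFamily O d ε P) {x : Sph n} (hx : x ∈ O) :
    1 - d x / 8 ≤ radialHeight P x :=
  le_csInf (h.heights_nonempty hx) fun _ ht => by
    linarith [(h.mem_of_smul_mem ht.1.le ht.2.2).2.1]

lemma smul_mem_of_radialHeight_lt (h : IsFineFamily O d ε P) {x : Sph n} (hx : x ∈ O) {t : ℝ}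
    (ht : radialHeight P x < t) (ht1 : t < 1) : t • (x : Euc n) ∈ halfSpaceUnion P := by
  obtain ⟨s, hs, hst⟩ := exists_lt_of_csInf_lt (h.heights_nonempty hx) ht
  exact h.smul_mem_of_le hs.1.le hst.le ht1 hs.2.2

lemma smul_notMem_of_lt_radialHeight {x : Sph n} {t : ℝ} (h0 : 0 < t)
    (ht : t < radialHeight P x) (ht1 : t < 1) : t • (x : Euc n) ∉ halfSpaceUnion P := fun hmem =>
  (csInf_le (bddBelow_heights x) ⟨h0, ht1, hmem⟩).not_gt ht

lemma radialHeight_smul_notMem (h : IsFineFamily O d ε P) {x : Sph n} (hx : x ∈ O) :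
    radialHeight P x • (x : Euc n) ∉ halfSpaceUnion P := by
  intro hmem
  have h1 := h.half_le_radialHeight hx
  have h2 : ContinuousAt (fun t : ℝ => t • (x : Euc n)) (radialHeight P x) := by fun_prop
  have h3 := h2.eventually ((isOpen_halfSpaceUnion P).mem_nhds hmem)
  obtain ⟨t, ht, ht1⟩ := (((h3.filter_mono nhdsWithin_le_nhds).and
    (self_mem_nhdsWithin (s := Iio (radialHeight P x)))).and
      ((eventually_gt_nhds (show (0 : ℝ) < radialHeight P x by linarith)).filter_mono
        nhdsWithin_le_nhds)).exists
  exact smul_notMem_of_lt_radialHeight ht1 ht.2 (lt_trans ht.2 (h.radialHeight_lt_one hx)) ht.1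

lemma radialHeight_smul_mem_closure (h : IsFineFamily O d ε P) {x : Sph n} (hx : x ∈ O) :
    radialHeight P x • (x : Euc n) ∈ closure (halfSpaceUnion P) := by
  have h2 : ContinuousWithinAt (fun t : ℝ => t • (x : Euc n))
      (Ioo (radialHeight P x) 1) (radialHeight P x) := by fun_prop
  have h3 := h2.mem_closure_image (by
    rw [closure_Ioo (h.radialHeight_lt_one hx).ne]
    exact left_mem_Icc.2 (h.radialHeight_lt_one hx).le)
  refine closure_mono ?_ h3
  rintro _ ⟨t, ht, rfl⟩
  exact h.smul_mem_of_radialHeight_lt hx ht.1 ht.2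

theorem frontier_inter_unitBall (h : IsFineFamily O d ε P) (hO : O.Nonempty) :
    frontier (halfSpaceUnion P) ∩ unitBall n =
      {z | ∃ x ∈ O, z = radialHeight P x • (x : Euc n)} := by
  rw [(isOpen_halfSpaceUnion P).frontier_eq]
  ext z
  constructor
  · rintro ⟨⟨hcl, hnot⟩, hzb⟩
    obtain ⟨x, t, h0, ht1, rfl, hx0⟩ : ∃ (x : Sph n) (t : ℝ), 0 ≤ t ∧ t < 1 ∧
        z = t • (x : Euc n) ∧ (t = 0 → x ∈ O) := by
      have hz1 : ‖z‖ < 1 := mem_ball_zero_iff.1 hzb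
      by_cases hz : z = 0
      -- The origin lies on every ray, so any point of `O` serves; `t = 0` is then excluded below
      -- because heights are positive.
      · exact ⟨hO.some, 0, le_rfl, one_pos, by simp [hz], fun _ => hO.some_mem⟩
      · have hz' : ‖z‖ ≠ 0 := by simpa using hz
        refine ⟨⟨‖z‖⁻¹ • z, ?_⟩, ‖z‖, norm_nonneg z, hz1, ?_, fun h => absurd h hz'⟩
        · rw [mem_sphere_zero_iff_norm, norm_smul, norm_inv, norm_norm, inv_mul_cancel₀ hz']
        · simp [smul_smul, hz']
    have hxO : x ∈ O := by
      by_contra hxO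
      obtain ⟨s, hs, hs1⟩ := exists_between ht1
      exact h.smul_notMem_closure h0 hs hs1
        (fun hmem => hxO (h.mem_of_smul_mem (h0.trans hs.le) hmem).1) hcl
    refine ⟨x, hxO, ?_⟩
    rcases lt_trichotomy t (radialHeight P x) with hlt | heq | hgt
    · obtain ⟨s, hs, hs1⟩ := exists_between hlt
      have hs2 := hs1.trans (h.radialHeight_lt_one hxO)
      exact absurd hcl (h.smul_notMem_closure h0 hs hs2
        (smul_notMem_of_lt_radialHeight (h0.trans_lt hs) hs1 hs2))
    · rw [heq]
    · exact absurd (h.smul_mem_of_radialHeight_lt hxO hgt ht1) hnot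
  · rintro ⟨x, hx, rfl⟩
    refine ⟨⟨h.radialHeight_smul_mem_closure hx, h.radialHeight_smul_notMem hx⟩, ?_⟩
    rw [unitBall, mem_ball_zero_iff, norm_smul_coe (by linarith [h.half_le_radialHeight hx])]
    exact h.radialHeight_lt_one hx

lemma radialHeight_le_add (h : IsFineFamily O d ε P) {x x' : Sph n} (hx : x ∈ O) (hx' : x' ∈ O) :
    radialHeight P x' ≤ radialHeight P x + 8 / ε * ‖(x : Euc n) - x'‖ := by
  have hε := h.eps_pos
  rw [← sub_le_iff_le_add]
  refine le_of_forall_gt_imp_ge_of_dense fun t₀ ht₀ => ?_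
  set δ := ‖(x : Euc n) - x'‖ with hδ
  have hδ0 : 0 ≤ δ := norm_nonneg _
  -- If the height at `x'` exceeded `t + m`, then `(t + m) • x'` would lie outside the half-space
  -- containing `t • x`. Comparing the two inequalities for this one half-space gives the
  -- contradiction; `8 / ε` makes the final estimates balance.
  set m := 8 / ε * δ with hm
  have hm0 : 0 ≤ m := by positivity
  obtain ⟨t, ⟨ht0, ht1, htmem⟩, htt⟩ := exists_lt_of_csInf_lt (h.heights_nonempty hx) ht₀
  refine le_trans ?_ htt.le
  rw [sub_le_iff_le_add]
  by_contra! hcon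
  have ht'1 : t + m < 1 := hcon.trans (h.radialHeight_lt_one hx')
  have hnot := smul_notMem_of_lt_radialHeight (by linarith) hcon ht'1
  have hfar : ε * d x' / 4 < 1 - (t + m) := by
    by_contra! hle
    exact hnot (h.smul_mem_of_one_sub_le hx' ht'1 hle)
  obtain ⟨p, hp, hz⟩ := mem_halfSpaceUnion.1 htmem
  obtain ⟨hxp, htr⟩ := h.of_smul_mem hp ht0.le hz
  have hr := h.radius_le p hp x hxp
  have hc := h.half_le_cos hp
  have h1 := ((smul_mem_halfSpace_iff ht0.le).1 hz).2
  have h2 : 2 * (t + m) * inner ℝ (x' : Euc n) (p.1 : Euc n) ≤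
      (1 + (t + m) ^ 2) * Real.cos p.2 := by
    by_contra! hlt
    exact hnot (mem_halfSpaceUnion.2 ⟨p, hp,
      (smul_mem_halfSpace_iff (by linarith)).2 ⟨ht'1, hlt⟩⟩)
  -- Near the centre the cosine is almost stationary, so a displacement `δ` changes it by `δ` times
  -- the radius, up to `δ ^ 2`. This extra factor of order `d` compensates the height of order `ε *
  -- d` on the other side.
  have hinner : inner ℝ (x : Euc n) (p.1 : Euc n) - inner ℝ (x' : Euc n) (p.1 : Euc n) ≤
      δ * (p.2 + δ) := by
    have e1 : ‖(p.1 : Euc n) - x'‖ ≤ p.2 + δ := by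
      have e2 : ‖(p.1 : Euc n) - x'‖ ≤ ‖(p.1 : Euc n) - x‖ + ‖(x : Euc n) - x'‖ :=
        norm_sub_le_norm_sub_add_norm_sub _ _ _
      have e3 : ‖(p.1 : Euc n) - x‖ ≤ sphDist p.1 x := norm_sub_le_sphDist _ _
      have e4 : sphDist x p.1 < p.2 := hxp
      rw [sphDist_comm] at e4
      linarith
    have e5 : inner ℝ ((x : Euc n) - x') ((p.1 : Euc n) - x') ≤ δ * (p.2 + δ) :=
      (real_inner_le_norm _ _).trans (mul_le_mul_of_nonneg_left e1 hδ0)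
    have e6 : inner ℝ ((x : Euc n) - x') (x' : Euc n) ≤ 0 := by
      rw [inner_sub_left, real_inner_self_eq_norm_sq, norm_coe_sphere, ← cos_sphDist]
      linarith [Real.cos_le_one (sphDist x x')]
    rw [inner_sub_right, inner_sub_left] at e5
    linarith
  have hεm : ε * m = 8 * δ := by rw [hm]; field_simp
  have hδm : 8 * δ ≤ m := by nlinarith [h.eps_le]
  -- Here `8 * δ ≤ m < 1 - t < p.2 ≤ d x / 8`, so `δ` is tiny compared with `d x`.
  have hd : d x ≤ 2 * d x' := by
    linarith [h.le_add x x', sphDist_le_two_mul_norm_sub x x']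
  have hd' := h.pos x' hx'
  have hcomb : m * (1 - t * (t + m)) * Real.cos p.2 < 2 * t * (t + m) * (δ * (p.2 + δ)) := by
    have a1 := mul_lt_mul_of_pos_left h1 (show 0 < t + m by linarith)
    have a2 := mul_le_mul_of_nonneg_left h2 ht0.le
    have a3 := mul_le_mul_of_nonneg_left hinner (show 0 ≤ 2 * t * (t + m) by positivity)
    linarith
  have hr0 := h.radius_pos p hp
  have hright : 2 * t * (t + m) * (δ * (p.2 + δ)) ≤ 2 * (δ * (d x' / 2)) := by
    have b1 : t * (t + m) ≤ 1 := by nlinarith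
    have b2 : p.2 + δ ≤ d x' / 2 := by linarith
    calc 2 * t * (t + m) * (δ * (p.2 + δ)) = 2 * (t * (t + m)) * (δ * (p.2 + δ)) := by ring
      _ ≤ 2 * 1 * (δ * (d x' / 2)) := by gcongr
      _ = _ := by ring
  have hleft : m * (ε * d x' / 4) * (1 / 2) ≤ m * (1 - t * (t + m)) * Real.cos p.2 := by
    have b1 : ε * d x' / 4 ≤ 1 - t * (t + m) := by nlinarith
    have b2 : 0 ≤ 1 - t * (t + m) := by nlinarith
    gcongr
  have : m * (ε * d x' / 4) * (1 / 2) = δ * d x' := by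
    linear_combination d x' / 8 * hεm
  linarith

theorem abs_radialHeight_sub_le (h : IsFineFamily O d ε P) {x y : Sph n} (hx : x ∈ O)
    (hy : y ∈ O) : |radialHeight P x - radialHeight P y| ≤ 8 / ε * sphDist x y := by
  have hε := h.eps_pos
  have h1 := h.radialHeight_le_add hx hy
  have h2 := h.radialHeight_le_add hy hx
  rw [norm_sub_rev] at h2
  have h3 : 8 / ε * ‖(x : Euc n) - y‖ ≤ 8 / ε * sphDist x y := by
    gcongr; exact norm_sub_le_sphDist x y
  rw [abs_le]
  constructor <;> linarith

end IsFineFamily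

end RadialGraph

/-! ### Group action: distortion of balls, invariance, and the fine family. -/

section Group

variable {n : ℕ} {Γ : Subgroup (Sph n ≃ₜ Sph n)}

lemma isOpen_discontinuityDomain (Γ : Subgroup (Sph n ≃ₜ Sph n)) :
    IsOpen (discontinuityDomain Γ) := by
  rw [isOpen_iff_mem_nhds]
  rintro x ⟨U, hU, hx, hfin⟩
  filter_upwards [hU.mem_nhds hx] with y hy
  exact ⟨U, hU, hy, hfin⟩

lemma apply_mem_discontinuityDomain {γ : Sph n ≃ₜ Sph n} (hγ : γ ∈ Γ) {x : Sph n}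
    (hx : x ∈ discontinuityDomain Γ) : γ x ∈ discontinuityDomain Γ := by
  obtain ⟨U, hU, hxU, hfin⟩ := hx
  refine ⟨γ '' U, γ.isOpen_image.2 hU, mem_image_of_mem _ hxU, ?_⟩
  refine (hfin.image fun δ => γ * δ * γ⁻¹).subset ?_
  rintro δ ⟨hδ, z, ⟨_, ⟨u, hu, rfl⟩, rfl⟩, v, hv, hvz⟩
  refine ⟨γ⁻¹ * δ * γ, ⟨Γ.mul_mem (Γ.mul_mem (Γ.inv_mem hγ) hδ) hγ, v, ⟨u, hu, ?_⟩, hv⟩, ?_⟩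
  · change γ.symm (δ (γ u)) = v
    rw [← hvz, γ.symm_apply_apply]
  · simp only
    group

lemma image_discontinuityDomain {γ : Sph n ≃ₜ Sph n} (hγ : γ ∈ Γ) :
    γ '' discontinuityDomain Γ = discontinuityDomain Γ := by
  apply Subset.antisymm
  · rintro _ ⟨x, hx, rfl⟩
    exact apply_mem_discontinuityDomain hγ hx
  · intro x hx
    exact ⟨γ⁻¹ x, apply_mem_discontinuityDomain (Γ.inv_mem hγ) hx, γ.apply_symm_apply x⟩

lemma apply_mem_limitSet {γ : Sph n ≃ₜ Sph n} (hγ : γ ∈ Γ) {x : Sph n}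
    (hx : x ∈ limitSet Γ) : γ x ∈ limitSet Γ := by
  have : γ '' limitSet Γ = limitSet Γ := by
    rw [limitSet, γ.image_frontier, image_discontinuityDomain hγ]
  rw [← this]
  exact mem_image_of_mem _ hx

/-- If `x` and `y` are close compared with the distances of `x` from `a` and `b`, then their
cross ratio with `a` and `b` is small. -/
lemma norm_sub_mul_norm_sub_le {E : Type*} [NormedAddCommGroup E] {x y a b : E} {e : ℝ}
    (he0 : 0 ≤ e) (he : e ≤ 1 / 4) (ha : ‖x - y‖ ≤ e * ‖x - a‖) (hb : ‖x - y‖ ≤ e * ‖x - b‖) :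
    ‖a - b‖ * ‖x - y‖ ≤ 4 * e * (‖x - a‖ * ‖y - b‖) := by
  have h1 : ‖x - b‖ ≤ ‖x - y‖ + ‖y - b‖ := norm_sub_le_norm_sub_add_norm_sub _ _ _
  have h2 : ‖a - b‖ ≤ ‖a - x‖ + ‖x - b‖ := norm_sub_le_norm_sub_add_norm_sub _ _ _
  rw [norm_sub_rev a x] at h2
  have := norm_nonneg (x - y)
  have := norm_nonneg (a - b)
  have := norm_nonneg (x - a)
  have := norm_nonneg (y - b)
  have := norm_nonneg (x - b)
  -- If `a` and `b` are not far apart relative to `‖x - a‖`, compare `‖x - b‖` with `‖y - b‖`;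
  -- otherwise `‖a - b‖` itself is comparable to `‖y - b‖`.
  rcases le_total (‖a - b‖) (2 * ‖x - a‖) with h | h
  · have h3 : ‖x - y‖ ≤ 2 * e * ‖y - b‖ := by nlinarith
    calc ‖a - b‖ * ‖x - y‖ ≤ (2 * ‖x - a‖) * (2 * e * ‖y - b‖) := by gcongr
      _ = _ := by ring
  · have h3 : ‖a - b‖ ≤ 4 * ‖y - b‖ := by nlinarith
    calc ‖a - b‖ * ‖x - y‖ ≤ (4 * ‖y - b‖) * (e * ‖x - a‖) := by gcongr
      _ = _ := by ring

/-- Elements of the group distort the distance to the limit set by a bounded amount: balls that are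
small compared with this distance are mapped into such balls. -/
lemma sphDist_apply_le (hΓ : Γ ≤ conformalGroup n) {b₁ b₂ : Sph n} (h₁ : b₁ ∈ limitSet Γ)
    (h₂ : b₂ ∈ limitSet Γ) (hb : b₁ ≠ b₂) {ε : ℝ} (hε0 : 0 ≤ ε) (hε : ε ≤ 1 / 8)
    {γ : Sph n ≃ₜ Sph n} (hγ : γ ∈ Γ) {x y : Sph n}
    (hxy : sphDist x y ≤ ε * sphInfDist x (limitSet Γ)) :
    sphDist (γ x) (γ y) ≤
      64 * ε / ‖(b₁ : Euc n) - b₂‖ * sphInfDist (γ x) (limitSet Γ) := by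
  obtain ⟨l, hl, hlγ⟩ := exists_conformal_factor (hΓ hγ)
  set D := ‖(b₁ : Euc n) - b₂‖ with hD
  have hD0 : 0 < D := norm_pos_iff.2 (sub_ne_zero.2 fun h => hb (Subtype.ext h))
  have hclose : ∀ a ∈ limitSet Γ, ‖(x : Euc n) - y‖ ≤ 2 * ε * ‖(x : Euc n) - a‖ := fun a ha => by
    have h3 := mul_le_mul_of_nonneg_left
      ((sphInfDist_le x ha).trans (sphDist_le_two_mul_norm_sub x a)) hε0
    linarith [norm_sub_le_sphDist x y]
  have key : ∀ a ∈ limitSet Γ, ‖(γ x : Euc n) - γ y‖ ≤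
      32 * ε / D * ‖(γ x : Euc n) - a‖ := by
    intro a' ha'
    obtain ⟨a, ha, rfl⟩ : ∃ a ∈ limitSet Γ, γ a = a' :=
      ⟨γ⁻¹ a', apply_mem_limitSet (Γ.inv_mem hγ) ha', γ.apply_symm_apply a'⟩
    -- By the triangle inequality one of `b₁`, `b₂` is this far from `γ a`. The cross ratio with `a`
    -- and the preimage of `b'` then controls `‖γ x - γ y‖`.
    obtain ⟨b', hb', hab'⟩ : ∃ b' ∈ limitSet Γ, D / 2 ≤ ‖(γ a : Euc n) - b'‖ := by
      by_contra! hcon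
      have e1 := hcon b₁ h₁
      have e2 := hcon b₂ h₂
      have e3 : D ≤ ‖(b₁ : Euc n) - γ a‖ + ‖(γ a : Euc n) - b₂‖ :=
        norm_sub_le_norm_sub_add_norm_sub _ _ _
      rw [norm_sub_rev] at e1
      linarith
    obtain ⟨b, hb, rfl⟩ : ∃ b ∈ limitSet Γ, γ b = b' :=
      ⟨γ⁻¹ b', apply_mem_limitSet (Γ.inv_mem hγ) hb', γ.apply_symm_apply b'⟩
    have hcross := norm_sub_mul_norm_sub_le (by linarith) (by linarith) (hclose a ha) (hclose b hb)
    have hpos : 0 ≤ l x * l y * l a * l b :=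
      (mul_pos (mul_pos (mul_pos (hl x) (hl y)) (hl a)) (hl b)).le
    have e1 : ‖(γ a : Euc n) - γ b‖ * ‖(γ x : Euc n) - γ y‖ ≤
        4 * (2 * ε) * (‖(γ x : Euc n) - γ a‖ * ‖(γ y : Euc n) - γ b‖) := by
      rw [hlγ, hlγ, hlγ, hlγ]
      linarith [mul_le_mul_of_nonneg_left hcross hpos]
    have e2 : ‖(γ y : Euc n) - γ b‖ ≤ 2 := by
      refine (norm_sub_le _ _).trans ?_
      rw [norm_coe_sphere, norm_coe_sphere]; norm_num
    rw [div_mul_eq_mul_div, le_div_iff₀ hD0]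
    have e3 := mul_le_mul_of_nonneg_right hab' (norm_nonneg ((γ x : Euc n) - γ y))
    have e4 : 4 * (2 * ε) * (‖(γ x : Euc n) - γ a‖ * ‖(γ y : Euc n) - γ b‖) ≤
        4 * (2 * ε) * (‖(γ x : Euc n) - γ a‖ * 2) := by gcongr
    linarith
  have hnn : 0 ≤ 64 * ε / D := by positivity
  -- Passing to the infimum over limit points divides by the constant, so the case of constant zero
  -- is separate. The factor `64` instead of `32` pays for replacing a chord by an angle.
  rcases hnn.eq_or_lt with h0 | h0
  · have e1 := key b₁ h₁
    have e2 : 32 * ε / D = 0 := by linear_combination -h0 / 2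
    rw [e2, zero_mul] at e1
    rw [← h0, zero_mul]
    linarith [sphDist_le_two_mul_norm_sub (γ x) (γ y)]
  · rw [← div_le_iff₀' h0]
    refine le_sphInfDist ⟨b₁, h₁⟩ fun a ha => ?_
    rw [div_le_iff₀' h0]
    have e1 := key a ha
    have e2 : 32 * ε / D * ‖(γ x : Euc n) - a‖ ≤ 32 * ε / D * sphDist (γ x) a := by
      gcongr; exact norm_sub_le_sphDist _ _
    have e3 := sphDist_le_two_mul_norm_sub (γ x) (γ y)
    have e4 : 64 * ε / D * sphDist (γ x) a = 2 * (32 * ε / D * sphDist (γ x) a) := by ring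
    linarith

/-- The centres and radii of the balls in the collection of the group. -/
def ballParameters (Γ : Subgroup (Sph n ≃ₜ Sph n)) (ε : ℝ) : Set (Sph n × ℝ) :=
  {p | 0 < p.2 ∧ p.2 < Real.pi ∧ sphBall p.1 p.2 ∈ ballCollection Γ ε}

lemma iUnion_halfSpaceOver_eq (Γ : Subgroup (Sph n ≃ₜ Sph n)) (ε : ℝ) :
    ⋃ D ∈ ballCollection Γ ε, halfSpaceOver D = halfSpaceUnion (ballParameters Γ ε) := by
  ext z
  simp only [mem_iUnion, exists_prop, mem_halfSpaceUnion, halfSpaceOver, mem_ofPred_eq]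
  constructor
  · rintro ⟨_, hD, y, r, h0, h1, rfl, hz⟩
    exact ⟨(y, r), ⟨h0, h1, hD⟩, hz⟩
  · rintro ⟨p, ⟨h0, h1, hD⟩, hz⟩
    exact ⟨_, hD, p.1, p.2, h0, h1, rfl, hz⟩

lemma IsMoebiusExtension.mapsTo_halfSpaceUnion {γ : Sph n ≃ₜ Sph n} {Φ : Euc n → Euc n}
    (h : IsMoebiusExtension γ Φ) (hγ : γ ∈ Γ) (ε : ℝ) :
    MapsTo Φ (halfSpaceUnion (ballParameters Γ ε)) (halfSpaceUnion (ballParameters Γ ε)) := by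
  intro z hz
  obtain ⟨p, ⟨h0, h1, δ, hδ, x, hx, hp⟩, hz⟩ := mem_halfSpaceUnion.1 hz
  obtain ⟨y', r', h2, h3, h4, h5⟩ := h.mapsHalfSpace p.1 p.2 h0 h1
  refine mem_halfSpaceUnion.2 ⟨(y', r'), ⟨h2, h3, γ * δ, Γ.mul_mem hγ hδ, x, hx, ?_⟩, h5 hz⟩
  simp only
  rw [← h4, hp, image_image]
  rfl

/-- The frontier of the open union is its closure minus itself: continuity of `Φ` preserves the
closure, and the inverse extension preserves the complement. -/
lemma IsMoebiusExtension.mapsTo_invariantGraph {γ : Sph n ≃ₜ Sph n} {Φ Ψ : Euc n → Euc n}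
    (h : IsMoebiusExtension γ Φ) (h' : IsMoebiusExtension γ⁻¹ Ψ) (hinv : ∀ z, Ψ (Φ z) = z)
    (hγ : γ ∈ Γ) (ε : ℝ) : MapsTo Φ (invariantGraph Γ ε) (invariantGraph Γ ε) := by
  rw [invariantGraph, iUnion_halfSpaceOver_eq, (isOpen_halfSpaceUnion _).frontier_eq]
  rintro z ⟨⟨hcl, hnot⟩, hzb⟩
  refine ⟨⟨?_, fun hmem => hnot ?_⟩, h.poincare.bijOn.mapsTo hzb⟩
  · have hcont : ContinuousWithinAt Φ (halfSpaceUnion (ballParameters Γ ε)) z :=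
      (h.poincare.continuousOn z (ball_subset_closedBall hzb)).mono
        ((halfSpaceUnion_subset _).trans ball_subset_closedBall)
    exact closure_mono (h.mapsTo_halfSpaceUnion hγ ε).image_subset (hcont.mem_closure_image hcl)
  · rw [← hinv z]
    exact h'.mapsTo_halfSpaceUnion (Γ.inv_mem hγ) ε hmem

theorem isInvariantUnder_invariantGraph (hΓ : Γ ≤ conformalGroup n) (ε : ℝ) :
    IsInvariantUnder Γ (invariantGraph Γ ε) := by
  intro γ hγ
  obtain ⟨Φ, Ψ, h1, h2, h3, h4⟩ := exists_extension_of_mem_conformalGroup (hΓ hγ)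
  refine ⟨Φ, h1.poincare, Subset.antisymm
    (h1.mapsTo_invariantGraph h2 h3 hγ ε).image_subset fun z hz => ⟨Ψ z, ?_, h4 z⟩⟩
  exact h2.mapsTo_invariantGraph (by rwa [inv_inv]) h4 (Γ.inv_mem hγ) ε hz

lemma notMem_limitSet {x : Sph n} (hx : x ∈ discontinuityDomain Γ) : x ∉ limitSet Γ := by
  rw [limitSet, (isOpen_discontinuityDomain Γ).frontier_eq]
  exact fun h => h.2 hx

theorem isFineFamily_ballParameters (hn : 1 ≤ n) (hΓ : Γ ≤ conformalGroup n) {b₁ b₂ : Sph n}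
    (h₁ : b₁ ∈ limitSet Γ) (h₂ : b₂ ∈ limitSet Γ) (hb : b₁ ≠ b₂) {ε : ℝ} (hε0 : 0 < ε)
    (hε : 2048 * ε ≤ ‖(b₁ : Euc n) - b₂‖) :
    IsFineFamily (discontinuityDomain Γ) (fun x => sphInfDist x (limitSet Γ)) ε
      (ballParameters Γ ε) := by
  have hne : (limitSet Γ).Nonempty := ⟨b₁, h₁⟩
  have hD0 : 0 < ‖(b₁ : Euc n) - b₂‖ := norm_pos_iff.2 (sub_ne_zero.2 fun h => hb (Subtype.ext h))
  have hD2 : ‖(b₁ : Euc n) - b₂‖ ≤ 2 := by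
    refine (norm_sub_le _ _).trans ?_
    rw [norm_coe_sphere, norm_coe_sphere]; norm_num
  have hpi := Real.pi_le_four
  have hpi3 := Real.pi_gt_three
  have hsub : ∀ x ∈ discontinuityDomain Γ,
      0 < sphInfDist x (limitSet Γ) ∧ ε * sphInfDist x (limitSet Γ) ≤ 1 ∧
      sphBall x (ε * sphInfDist x (limitSet Γ)) ⊆ discontinuityDomain Γ := fun x hx => by
    have e1 := sphInfDist_pos hne isClosed_frontier (notMem_limitSet hx)
    have e2 := sphInfDist_le_pi hne x
    have e3 : ε * sphInfDist x (limitSet Γ) ≤ 1 := by nlinarith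
    refine ⟨e1, e3, sphBall_subset_of_le_sphInfDist (isOpen_discontinuityDomain Γ) hx
      (mul_pos hε0 e1) (by linarith) ?_⟩
    change _ ≤ sphInfDist x (limitSet Γ)
    nlinarith
  refine ⟨hε0, by linarith, sphInfDist_le_add hne, sphInfDist_le_pi hne,
    fun x hx => (hsub x hx).1, fun p hp => hp.1, ?_, ?_, ?_⟩
  · rintro p ⟨-, -, γ, hγ, x, hx, hp⟩ w hw
    rw [hp] at hw
    obtain ⟨v, hv, rfl⟩ := hw
    exact apply_mem_discontinuityDomain hγ ((hsub x hx).2.2 hv)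
  · rintro p ⟨hr0, hr1, γ, hγ, x, hx, hp⟩ w hw
    -- With `2048 * ε ≤ D` the distortion constant `64 * ε / D` is at most `1 / 32`. Distances are
    -- measured from `γ x`, which need not be the centre of the image ball.
    have hnear : ∀ u ∈ sphBall p.1 p.2,
        sphDist (γ x) u ≤ 1 / 32 * sphInfDist (γ x) (limitSet Γ) := fun u hu => by
      rw [hp] at hu
      obtain ⟨v, hv, rfl⟩ := hu
      have hv' : sphDist x v ≤ ε * sphInfDist x (limitSet Γ) := by
        rw [sphDist_comm]; exact le_of_lt hv
      refine (sphDist_apply_le hΓ h₁ h₂ hb hε0.le (by linarith) hγ hv').trans ?_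
      have := sphInfDist_nonneg (γ x) (limitSet Γ)
      refine mul_le_mul_of_nonneg_right ?_ this
      rw [div_le_iff₀ hD0]
      linarith
    -- The ball contains points at every distance `s < p.2` from its centre, as `1 ≤ n`; both such a
    -- point and the centre are within `1 / 32` of the distance from `γ x`.
    have hradius : p.2 ≤ 1 / 16 * sphInfDist (γ x) (limitSet Γ) := by
      refine le_of_forall_lt_imp_le_of_dense fun s hs => ?_
      rcases le_total s 0 with hs0 | hs0
      · linarith [sphInfDist_nonneg (γ x) (limitSet Γ)]
      obtain ⟨u, hu⟩ := exists_sphDist_eq hn p.1 hs0 (hs.le.trans hr1.le)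
      have e1 := hnear u (by rw [← hu] at hs; exact hs)
      have e2 := hnear p.1 (mem_sphBall_self _ hr0)
      have e3 := sphDist_triangle u (γ x) p.1
      rw [sphDist_comm u (γ x)] at e3
      linarith
    have e1 := hnear w hw
    have e2 := sphInfDist_le_add hne (γ x) w
    linarith [sphInfDist_nonneg (γ x) (limitSet Γ)]
  · intro x hx
    obtain ⟨e1, e2, -⟩ := hsub x hx
    exact ⟨mul_pos hε0 e1, by simp only; linarith, 1, Γ.one_mem, x, hx, (image_id _).symm⟩

/-- The zero-dimensional sphere has only two points. Positive dimension is needed to bound the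
radius of a ball by its extent. -/
lemma one_le_of_isNonelementary (h : IsNonelementary Γ) : 1 ≤ n := by
  by_contra hn
  obtain rfl : n = 0 := by omega
  have hsub : limitSet Γ ⊆ {x | (x : Euc 0) 0 = 1} ∪ {x | (x : Euc 0) 0 = -1} := by
    intro x _
    have h1 := norm_coe_sphere x
    rw [EuclideanSpace.norm_eq, Fin.sum_univ_one, Real.norm_eq_abs,
      Real.sqrt_sq (abs_nonneg _)] at h1
    exact eq_or_eq_neg_of_abs_eq h1
  have hsing : ∀ c : ℝ, {x : Sph 0 | (x : Euc 0) 0 = c}.encard ≤ 1 := fun c => by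
    refine encard_le_one_iff.2 fun x y hx hy => ?_
    apply Subtype.ext
    ext i
    obtain rfl : i = 0 := Fin.fin_one_eq_zero i
    exact hx.trans hy.symm
  have h2 := (encard_le_encard hsub).trans ((encard_union_le _ _).trans
    (add_le_add (hsing 1) (hsing (-1))))
  rw [one_add_one_eq_two] at h2
  exact absurd h (not_lt.2 h2)

end Group

end KleinianGraph

theorem proposition1p1 :
    ∃ C₁ C₂ : ℝ → ℝ, (∀ ε : ℝ, 0 < ε → 0 < C₁ ε) ∧
      ∀ (n : ℕ) (Γ : Subgroup (KleinianGraph.Sph n ≃ₜ KleinianGraph.Sph n)),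
        KleinianGraph.IsKleinian Γ → KleinianGraph.IsNonelementary Γ →
        ∃ ε₁ : ℝ, 0 < ε₁ ∧ ∀ ε₀ : ℝ, 0 < ε₀ → ε₀ < ε₁ →
          KleinianGraph.IsInvariantUnder Γ (KleinianGraph.invariantGraph Γ ε₀) ∧
          ∃ f : KleinianGraph.Sph n → ℝ,
            (∀ x ∈ KleinianGraph.discontinuityDomain Γ, 0 < f x ∧ f x < 1) ∧
            KleinianGraph.invariantGraph Γ ε₀ =
              {z | ∃ x ∈ KleinianGraph.discontinuityDomain Γ,
                z = f x • (x : KleinianGraph.Euc n)} ∧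
            (∃ M : ℝ, 0 < M ∧
              ∀ x ∈ KleinianGraph.discontinuityDomain Γ,
              ∀ y ∈ KleinianGraph.discontinuityDomain Γ,
                |f x - f y| ≤ M * KleinianGraph.sphDist x y) ∧
            ∀ x ∈ KleinianGraph.discontinuityDomain Γ,
              0 < KleinianGraph.sphInfDist x (KleinianGraph.limitSet Γ) ∧
              C₁ ε₀ ≤ (1 - f x) / KleinianGraph.sphInfDist x (KleinianGraph.limitSet Γ) ∧
              (1 - f x) / KleinianGraph.sphInfDist x (KleinianGraph.limitSet Γ) ≤ C₂ ε₀ := by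
  open KleinianGraph in
  -- The lower constant comes from `radialHeight_le`; the upper one could be `1 / 8`, by
  -- `le_radialHeight`.
  refine ⟨fun ε => ε / 4, fun _ => 1, fun ε hε => by simp only; linarith, fun n Γ hΓ hne => ?_⟩
  have hn := one_le_of_isNonelementary hne
  obtain ⟨b₁, b₂, h₁, h₂, hb⟩ := Set.one_lt_encard_iff.1 (lt_trans (by norm_num) hne)
  have hD : 0 < ‖(b₁ : Euc n) - b₂‖ := norm_pos_iff.2 (sub_ne_zero.2 fun h => hb (Subtype.ext h))
  refine ⟨‖(b₁ : Euc n) - b₂‖ / 2048, by positivity, fun ε hε0 hε => ?_⟩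
  have hF := isFineFamily_ballParameters hn hΓ.conformal h₁ h₂ hb hε0 (by linarith)
  refine ⟨isInvariantUnder_invariantGraph hΓ.conformal ε, radialHeight (ballParameters Γ ε),
    fun x hx => ⟨by linarith [hF.half_le_radialHeight hx], hF.radialHeight_lt_one hx⟩, ?_,
    ⟨8 / ε, by positivity, fun x hx y hy => hF.abs_radialHeight_sub_le hx hy⟩, fun x hx => ?_⟩
  · rw [invariantGraph, iUnion_halfSpaceOver_eq]
    exact hF.frontier_inter_unitBall hΓ.nonempty
  · have h1 : 0 < sphInfDist x (limitSet Γ) := hF.pos x hx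
    have h2 := hF.radialHeight_le hx
    have h3 := hF.le_radialHeight hx
    refine ⟨h1, ?_, ?_⟩
    · rw [le_div_iff₀ h1]; linarith
    · rw [div_le_iff₀ h1]; linarith
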